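/- Let $\mathbb{K}$ be a field of characteristic $0$ and let $\mathcal{D}$ be a non-empty class of finite groups closed under isomorphisms, subgroups, quotients and direct products (for instance, all finite groups). The biset category $\mathbb{K}\mathcal{D}$ has the groups in $\mathcal{D}$ as objects, the morphisms from $G$ to $H$ being $\mathbb{K}\otimes_{\mathbb{Z}}B(H,G)$, where $B(H,G)$ is the Grothendieck group of finite $(H,G)$-bisets under disjoint union; composition is induced by the tensor product of bisets. A Green biset functor $A$ is a $\mathbb{K}$-linear functor from $\mathbb{K}\mathcal{D}$ to $\mathbb{K}$-modules such that every $A(G)$ is a unital $\mathbb{K}$-algebra and, for every group homomorphism $\varphi:K\to G$ in $\mathcal{D}$, the map $\varphi^*:A(G)\to A(K)$ given by the $(K,G)$-biset $G$ is a ring homomorphism and the map $\varphi_*:A(K)\to A(G)$ given by the $(G,K)$-biset $G$ satisfies $\varphi_*(a)\cdot b=\varphi_*(a\cdot\varphi^*(b))$ and $b\cdot\varphi_*(a)=\varphi_*(\varphi^*(b)\cdot a)$. Write $A(\mathrm{Res}^G_K)=\varphi^*$ for an inclusion $\varphi:K\hookrightarrow G$ and $A(\mathrm{Def}^G_{G/N})=\varphi_*$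 for a projection $\varphi:G\to G/N$, and put $a\times b=p_1^*(a)\cdot p_2^*(b)\in A(G\times H)$ for $a\in A(G)$, $b\in A(H)$, where $p_1,p_2$ are the projections of $G\times H$. An ideal $I$ of $A$ is a biset subfunctor such that $a\times x$ and $x\times a$ belong to $I$ (evaluated at the corresponding product group) whenever $x\in I(H)$ and $a\in A(G)$. The ideal generated by an element of $A(G)$ is the intersection of all ideals containing it, and sums of ideals are taken evaluation by evaluation. Assume that for every $G\in\mathcal{D}$ the algebra $A(G)$ is a finite dimensional split semisimple commutative $\mathbb{K}$-algebra, i.e. $A(G)\cong\mathbb{K}^n$ for some $n\ge 0$ depending on $G$. Let $E_G$ be the set of primitive idempotents of $A(G)$, and for $e\in E_G$ let $\mathbf{e}$ be the ideal of $A$ generated by $e$. For $H\in\mathcal{D}$ let $$\underline{E_H}=\{e\in E_H : A(\mathrm{Res}^H_K)(e)=0\ \text{ for all } K<H\},\qquad \underline{\underline{E_H}}=\{e\in E_H : A(\mathrm{Def}^H_{H/N})(e)=0\ \text{ for all } 1\neq N\trianglelefteq H\},$$ and call $H$ an $MC$-group of $A$ if $\underline{E_H}\cap\underline{\underline{E_H}}\neq\emptyset$.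 Then: 1. For every $G\in\mathcal{D}$ and every $e_G\in E_G$ there are an $MC$-group $H\in\mathcal{D}$ of $A$ and $e_H\in\underline{E_H}\cap\underline{\underline{E_H}}$ such that $\mathbf{e_G}=\mathbf{e_H}$. 2. For every ideal $I$ of $A$, $$I=\sum_{(H,e_H)\in\mathcal{A}_I}\mathbf{e_H},\qquad \mathcal{A}_I=\{(H,e_H) : H \text{ is an } MC\text{-group of } A,\ e_H\in\underline{E_H}\cap\underline{\underline{E_H}},\ e_H\in I(H)\}.$$ -/

import Mathlib

open scoped TensorProduct MulOpposite

universe u v w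

namespace GreenBiset

/-! ### Finite bisets and their Grothendieck group -/

/-- A finite `(H, G)`-biset: a finite set with a left action of `H` and a right action of `G`
(a left action of `Gᵐᵒᵖ`) that commute. -/
structure FinBiset (H G : Type u) [Group H] [Group G] where
  carrier : Type u
  [finite : Finite carrier]
  [left : MulAction H carrier]
  [right : MulAction Gᵐᵒᵖ carrier]
  comm : ∀ (h : H) (g : Gᵐᵒᵖ) (x : carrier), h • g • x = g • h • x

attribute [instance] FinBiset.finite FinBiset.left FinBiset.right

instance FinBiset.smulCommClass {H G : Type u} [Group H] [Group G] (X : FinBiset H G) :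
    SMulCommClass H Gᵐᵒᵖ X.carrier := ⟨X.comm⟩

namespace FinBiset

section

variable {K H G : Type u} [Group K] [Group H] [Group G]

/-- Two `(H, G)`-bisets are isomorphic if there is a bijection compatible with both actions. -/
def Iso (X Y : FinBiset H G) : Prop :=
  ∃ e : X.carrier ≃ Y.carrier,
    (∀ (h : H) (x : X.carrier), e (h • x) = h • e x) ∧
      ∀ (g : Gᵐᵒᵖ) (x : X.carrier), e (g • x) = g • e x

theorem Iso.refl (X : FinBiset H G) : Iso X X :=
  ⟨Equiv.refl _, fun _ _ => rfl, fun _ _ => rfl⟩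

theorem Iso.symm {X Y : FinBiset H G} : Iso X Y → Iso Y X := by
  rintro ⟨e, h1, h2⟩
  refine ⟨e.symm, fun h y => ?_, fun g y => ?_⟩
  · rw [Equiv.symm_apply_eq, h1, Equiv.apply_symm_apply]
  · rw [Equiv.symm_apply_eq, h2, Equiv.apply_symm_apply]

theorem Iso.trans {X Y Z : FinBiset H G} : Iso X Y → Iso Y Z → Iso X Z := by
  rintro ⟨e, h1, h2⟩ ⟨f, k1, k2⟩
  exact ⟨e.trans f, fun h x => by simp [h1, k1], fun g x => by simp [h2, k2]⟩

instance setoid (H G : Type u) [Group H] [Group G] : Setoid (FinBiset H G) where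
  r := Iso
  iseqv := ⟨Iso.refl, Iso.symm, Iso.trans⟩

/-- The disjoint union of two bisets. -/
def sum (X Y : FinBiset H G) : FinBiset H G where
  carrier := X.carrier ⊕ Y.carrier
  comm := fun h g x => by cases x <;> simp [smul_comm h g]

/-- The empty biset. -/
def empty (H G : Type u) [Group H] [Group G] : FinBiset H G where
  carrier := PEmpty
  left := { toSMul := ⟨fun _ x => x⟩, one_smul := fun _ => rfl, mul_smul := fun _ _ _ => rfl }
  right := { toSMul := ⟨fun _ x => x⟩, one_smul := fun _ => rfl, mul_smul := fun _ _ _ => rfl }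
  comm := fun _ _ _ => rfl

/-- For a `(K, H)`-biset `V` and an `(H, G)`-biset `U`, the relation identifying
`(v · h, u)` with `(v, h · u)`, i.e. `(v, u)` with `(v · h, h⁻¹ · u)`. -/
def tensorSetoid (V : FinBiset K H) (U : FinBiset H G) : Setoid (V.carrier × U.carrier) where
  r p q := ∃ h : H, q = (MulOpposite.op h • p.1, h⁻¹ • p.2)
  iseqv :=
    { refl := fun p => ⟨1, by simp⟩
      symm := by
        rintro ⟨v, x⟩ _ ⟨h, rfl⟩
        exact ⟨h⁻¹, by simp [smul_smul]⟩
      trans := by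
        rintro ⟨v, x⟩ _ _ ⟨h, rfl⟩ ⟨k, rfl⟩
        exact ⟨h * k, by simp [smul_smul]⟩ }

/-- The tensor product `V ×_H U` of a `(K, H)`-biset and an `(H, G)`-biset: the set of orbits of
`V × U` under `H`, with `k · [v, u] · g = [k · v, u · g]`. -/
def tensor (V : FinBiset K H) (U : FinBiset H G) : FinBiset K G where
  carrier := Quotient (tensorSetoid V U)
  left :=
    { toSMul := ⟨fun k => Quotient.map' (fun p => (k • p.1, p.2)) (by
        rintro ⟨v, x⟩ _ ⟨h, rfl⟩
        exact ⟨h, by rw [V.comm]⟩)⟩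
      one_smul := by
        rintro ⟨p⟩
        exact congrArg (Quotient.mk _) (by simp)
      mul_smul := by
        rintro a b ⟨p⟩
        exact congrArg (Quotient.mk _) (by simp [mul_smul]) }
  right :=
    { toSMul := ⟨fun g => Quotient.map' (fun p => (p.1, g • p.2)) (by
        rintro ⟨v, x⟩ _ ⟨h, rfl⟩
        exact ⟨h, by rw [U.comm]⟩)⟩
      one_smul := by
        rintro ⟨p⟩
        exact congrArg (Quotient.mk _) (by simp)
      mul_smul := by
        rintro a b ⟨p⟩
        exact congrArg (Quotient.mk _) (by simp [mul_smul]) }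
  comm := by
    rintro k g ⟨p⟩
    rfl

theorem tensor_congr {V V' : FinBiset K H} {U U' : FinBiset H G} :
    Iso V V' → Iso U U' → Iso (tensor V U) (tensor V' U') := by
  rintro ⟨e, h1, h2⟩ ⟨f, k1, k2⟩
  refine ⟨Quotient.congr (Equiv.prodCongr e f) ?_, ?_, ?_⟩
  · rintro ⟨v, x⟩ ⟨v', x'⟩
    refine exists_congr fun h => ?_
    simp [Prod.ext_iff, ← h2, ← k1]
  · rintro k ⟨p⟩
    exact congrArg (Quotient.mk (tensorSetoid V' U')) (by simp [h1])
  · rintro g ⟨p⟩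
    exact congrArg (Quotient.mk (tensorSetoid V' U')) (by simp [k2])

/-- For a group homomorphism `f : K → G`, the set `G` as a `(K, G)`-biset: `k · x · g = f k * x * g`. -/
def ofHom {K G : Type u} [Group K] [Group G] [Finite G] (f : K →* G) : FinBiset K G where
  carrier := G
  left :=
    { toSMul := ⟨fun k x => f k * x⟩
      one_smul := fun x => by change f 1 * x = x; simp
      mul_smul := fun a b x => by change f (a * b) * x = f a * (f b * x); simp [mul_assoc] }
  right :=
    { toSMul := ⟨fun g x => x * g.unop⟩
      one_smul := fun x => by change x * 1 = x; simp
      mul_smul := fun a b x => by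
        change x * (a * b).unop = x * b.unop * a.unop
        simp [mul_assoc] }
  comm := fun k g x => by
    change f k * (x * g.unop) = f k * x * g.unop
    simp [mul_assoc]

/-- For a group homomorphism `f : K → G`, the set `G` as a `(G, K)`-biset: `g · x · k = g * x * f k`. -/
def ofHomOp {K G : Type u} [Group K] [Group G] [Finite G] (f : K →* G) : FinBiset G K where
  carrier := G
  left :=
    { toSMul := ⟨fun g x => g * x⟩
      one_smul := fun x => by change 1 * x = x; simp
      mul_smul := fun a b x => by change a * b * x = a * (b * x); simp [mul_assoc] }
  right :=
    { toSMul := ⟨fun k x => x * f k.unop⟩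
      one_smul := fun x => by change x * f 1 = x; simp
      mul_smul := fun a b x => by
        change x * f (a * b).unop = x * f b.unop * f a.unop
        simp [mul_assoc] }
  comm := fun g k x => by
    change g * (x * f k.unop) = g * x * f k.unop
    simp [mul_assoc]

end

end FinBiset

/-- Isomorphism classes of finite `(H, G)`-bisets. -/
def BisetClass (H G : Type u) [Group H] [Group G] : Type (u + 1) :=
  Quotient (FinBiset.setoid H G)

section

variable {K H G : Type u} [Group K] [Group H] [Group G]

/-- The isomorphism class of a biset. -/
def BisetClass.mk (X : FinBiset H G) : BisetClass H G :=
  Quotient.mk (FinBiset.setoid H G) X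

instance BisetClass.instZero : Zero (BisetClass H G) :=
  ⟨BisetClass.mk (FinBiset.empty H G)⟩

instance BisetClass.instAdd : Add (BisetClass H G) :=
  ⟨Quotient.map₂ FinBiset.sum (by
    rintro X X' ⟨e, h1, h2⟩ Y Y' ⟨f, k1, k2⟩
    refine ⟨Equiv.sumCongr e f, ?_, ?_⟩
    · rintro h (x | x)
      · exact congrArg Sum.inl (h1 h x)
      · exact congrArg Sum.inr (k1 h x)
    · rintro h (x | x)
      · exact congrArg Sum.inl (h2 h x)
      · exact congrArg Sum.inr (k2 h x))⟩

/-- Isomorphism classes form a commutative monoid under disjoint union. -/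
instance BisetClass.addCommMonoid : AddCommMonoid (BisetClass H G) where
  add_assoc := by
    rintro ⟨X⟩ ⟨Y⟩ ⟨Z⟩
    refine Quotient.sound ⟨Equiv.sumAssoc _ _ _, ?_, ?_⟩ <;> rintro h ((x | x) | x) <;> rfl
  zero_add := by
    rintro ⟨X⟩
    refine Quotient.sound ⟨Equiv.emptySum PEmpty _, ?_, ?_⟩ <;> rintro h (x | x) <;>
      first | exact x.elim | rfl
  add_zero := by
    rintro ⟨X⟩
    refine Quotient.sound ⟨Equiv.sumEmpty _ PEmpty, ?_, ?_⟩ <;> rintro h (x | x) <;>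
      first | exact x.elim | rfl
  add_comm := by
    rintro ⟨X⟩ ⟨Y⟩
    refine Quotient.sound ⟨Equiv.sumComm _ _, ?_, ?_⟩ <;> rintro h (x | x) <;> rfl
  nsmul := nsmulRec

/-- The tensor product of bisets on isomorphism classes. -/
def BisetClass.tensor : BisetClass K H → BisetClass H G → BisetClass K G :=
  Quotient.map₂ FinBiset.tensor fun _ _ h _ _ k => FinBiset.tensor_congr h k

theorem BisetClass.tensor_zero (V : BisetClass K H) :
    V.tensor (0 : BisetClass H G) = 0 := by
  obtain ⟨V⟩ := V
  have : IsEmpty (FinBiset.tensor V (FinBiset.empty H G)).carrier :=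
    ⟨by rintro ⟨_, x⟩; exact x.elim⟩
  exact Quotient.sound ⟨(Equiv.equivPEmpty _ : _ ≃ PEmpty),
    fun _ x => isEmptyElim x, fun _ x => isEmptyElim x⟩

theorem BisetClass.zero_tensor (U : BisetClass H G) :
    (0 : BisetClass K H).tensor U = 0 := by
  obtain ⟨U⟩ := U
  have : IsEmpty (FinBiset.tensor (FinBiset.empty K H) U).carrier :=
    ⟨by rintro ⟨x, _⟩; exact x.elim⟩
  exact Quotient.sound ⟨(Equiv.equivPEmpty _ : _ ≃ PEmpty),
    fun _ x => isEmptyElim x, fun _ x => isEmptyElim x⟩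

theorem BisetClass.tensor_add (V : BisetClass K H) (U U' : BisetClass H G) :
    V.tensor (U + U') = V.tensor U + V.tensor U' := by
  obtain ⟨V⟩ := V
  obtain ⟨U⟩ := U
  obtain ⟨U'⟩ := U'
  refine Quotient.sound ⟨
    { toFun := Quotient.lift (fun p : V.carrier × (U.carrier ⊕ U'.carrier) =>
        Sum.elim (fun x => Sum.inl (Quotient.mk (FinBiset.tensorSetoid V U) (p.1, x)))
          (fun x => Sum.inr (Quotient.mk (FinBiset.tensorSetoid V U') (p.1, x))) p.2) ?_
      invFun := Sum.elim
        (Quotient.map' (fun p => (p.1, Sum.inl p.2)) ?_)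
        (Quotient.map' (fun p => (p.1, Sum.inr p.2)) ?_)
      left_inv := ?_
      right_inv := ?_ }, ?_, ?_⟩
  · rintro ⟨v, x | x⟩ _ ⟨h, rfl⟩
    · exact congrArg Sum.inl (Quotient.sound ⟨h, rfl⟩)
    · exact congrArg Sum.inr (Quotient.sound ⟨h, rfl⟩)
  · rintro ⟨v, x⟩ _ ⟨h, rfl⟩
    exact ⟨h, rfl⟩
  · rintro ⟨v, x⟩ _ ⟨h, rfl⟩
    exact ⟨h, rfl⟩
  · rintro ⟨v, x | x⟩ <;> rfl
  · rintro (⟨v, x⟩ | ⟨v, x⟩) <;> rfl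
  · rintro k ⟨v, x | x⟩ <;> rfl
  · rintro k ⟨v, x | x⟩ <;> rfl

theorem BisetClass.add_tensor (V V' : BisetClass K H) (U : BisetClass H G) :
    (V + V').tensor U = V.tensor U + V'.tensor U := by
  obtain ⟨V⟩ := V
  obtain ⟨V'⟩ := V'
  obtain ⟨U⟩ := U
  refine Quotient.sound ⟨
    { toFun := Quotient.lift (fun p : (V.carrier ⊕ V'.carrier) × U.carrier =>
        Sum.elim (fun x => Sum.inl (Quotient.mk (FinBiset.tensorSetoid V U) (x, p.2)))
          (fun x => Sum.inr (Quotient.mk (FinBiset.tensorSetoid V' U) (x, p.2))) p.1) ?_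
      invFun := Sum.elim
        (Quotient.map' (fun p => (Sum.inl p.1, p.2)) ?_)
        (Quotient.map' (fun p => (Sum.inr p.1, p.2)) ?_)
      left_inv := ?_
      right_inv := ?_ }, ?_, ?_⟩
  · rintro ⟨x | x, v⟩ _ ⟨h, rfl⟩
    · exact congrArg Sum.inl (Quotient.sound ⟨h, rfl⟩)
    · exact congrArg Sum.inr (Quotient.sound ⟨h, rfl⟩)
  · rintro ⟨v, x⟩ _ ⟨h, rfl⟩
    exact ⟨h, rfl⟩
  · rintro ⟨v, x⟩ _ ⟨h, rfl⟩
    exact ⟨h, rfl⟩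
  · rintro ⟨x | x, v⟩ <;> rfl
  · rintro (⟨v, x⟩ | ⟨v, x⟩) <;> rfl
  · rintro k ⟨x | x, v⟩ <;> rfl
  · rintro k ⟨x | x, v⟩ <;> rfl

/-- The tensor product as a biadditive map on isomorphism classes. -/
def BisetClass.tensorHom : BisetClass K H →+ BisetClass H G →+ BisetClass K G where
  toFun V :=
    { toFun := V.tensor
      map_zero' := BisetClass.tensor_zero V
      map_add' := BisetClass.tensor_add V }
  map_zero' := AddMonoidHom.ext BisetClass.zero_tensor
  map_add' V V' := AddMonoidHom.ext (BisetClass.add_tensor V V')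

end

/-- `B(H, G)`: the Grothendieck group of finite `(H, G)`-bisets with respect to disjoint union. -/
abbrev BurnsideGroup (H G : Type u) [Group H] [Group G] : Type (u + 1) :=
  Algebra.GrothendieckAddGroup (BisetClass H G)

/-- The composition `B(K, H) × B(H, G) → B(K, G)` induced by the tensor product of bisets. -/
noncomputable def BurnsideGroup.comp {K H G : Type u} [Group K] [Group H] [Group G] :
    BurnsideGroup K H →+ BurnsideGroup H G →+ BurnsideGroup K G :=
  Algebra.GrothendieckAddGroup.lift
    { toFun := fun V => Algebra.GrothendieckAddGroup.lift
        (Algebra.GrothendieckAddGroup.of.comp (BisetClass.tensorHom V))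
      map_zero' := by
        refine Algebra.GrothendieckAddGroup.lift.symm_apply_eq.mp ?_ |>.symm
        ext U
        simp
      map_add' := fun V V' => by
        refine Algebra.GrothendieckAddGroup.lift.symm.injective ?_
        ext U
        have h (W : BisetClass K H) :
            Algebra.GrothendieckAddGroup.lift
                (Algebra.GrothendieckAddGroup.of.comp (BisetClass.tensorHom W))
                (Algebra.GrothendieckAddGroup.of U) =
              Algebra.GrothendieckAddGroup.of (BisetClass.tensorHom (G := G) W U) :=
          DFunLike.congr_fun (Algebra.GrothendieckAddGroup.lift.symm_apply_apply _) U
        have h' := congrArg₂ (· + ·) (h V) (h V')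
        refine Eq.trans ?_ h'.symm
        simp
        rfl }

/-- `RB(H, G) = R ⊗_ℤ B(H, G)`: the morphisms from `G` to `H` in the biset category over `R`. -/
abbrev RB (R : Type w) [CommRing R] (H G : Type u) [Group H] [Group G] : Type (max w (u + 1)) :=
  R ⊗[ℤ] BurnsideGroup H G

namespace RB

section

variable (R : Type w) [CommRing R] {K H G : Type u} [Group K] [Group H] [Group G]

/-- The class of a finite `(H, G)`-biset in `RB(H, G)`. -/
noncomputable def of (U : FinBiset H G) : RB R H G :=
  1 ⊗ₜ[ℤ] Algebra.GrothendieckAddGroup.of (BisetClass.mk U)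

/-- The `R`-bilinear composition `RB(K, H) × RB(H, G) → RB(K, G)` of the biset category. -/
noncomputable def comp : RB R K H →ₗ[R] RB R H G →ₗ[R] RB R K G :=
  LinearMap.liftBaseChange R
    { toFun := fun V => LinearMap.baseChange R (BurnsideGroup.comp V).toIntLinearMap
      map_add' := fun V V' => by
        rw [map_add, ← LinearMap.baseChange_add]
        rfl
      map_smul' := fun n V => by
        rw [map_zsmul, RingHom.id_apply]
        change LinearMap.baseChange R (n • (BurnsideGroup.comp V).toIntLinearMap) = _
        rw [LinearMap.baseChange_smul] }

/-- The identity morphism of `G`: the class of the `(G, G)`-biset `G`. -/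
noncomputable def id (G : Type u) [Group G] [Finite G] : RB R G G :=
  of R (FinBiset.ofHom (MonoidHom.id G))

end

end RB

/-! ### Classes of finite groups -/

/-- A non-empty class of finite groups closed under isomorphisms, subgroups, quotients and direct
products. -/
structure GroupClass where
  mem : FiniteGrp.{u} → Prop
  nonempty : ∃ G, mem G
  of_iso : ∀ G H : FiniteGrp.{u}, Nonempty (G ≃* H) → mem G → mem H
  of_subgroup : ∀ (G : FiniteGrp.{u}) (K : Subgroup G), mem G → mem (FiniteGrp.of K)
  of_quotient : ∀ (G : FiniteGrp.{u}) (N : Subgroup G) [N.Normal], mem G →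
    mem (FiniteGrp.of (G ⧸ N))
  of_prod : ∀ G H : FiniteGrp.{u}, mem G → mem H → mem (FiniteGrp.of (G × H))

namespace GroupClass

/-- The groups belonging to the class. -/
def Obj (𝒟 : GroupClass.{u}) : Type (u + 1) := {G : FiniteGrp.{u} // 𝒟.mem G}

section

variable {𝒟 : GroupClass.{u}}

instance : CoeSort 𝒟.Obj (Type u) := ⟨fun G => G.1⟩

/-- A subgroup of a group in the class. -/
def Obj.sub (G : 𝒟.Obj) (K : Subgroup G) : 𝒟.Obj :=
  ⟨FiniteGrp.of K, 𝒟.of_subgroup G.1 K G.2⟩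

/-- A quotient of a group in the class. -/
def Obj.quot (G : 𝒟.Obj) (N : Subgroup G) [N.Normal] : 𝒟.Obj :=
  ⟨FiniteGrp.of (G ⧸ N), 𝒟.of_quotient G.1 N G.2⟩

/-- The direct product of two groups in the class. -/
def Obj.prod (G H : 𝒟.Obj) : 𝒟.Obj :=
  ⟨FiniteGrp.of (G × H), 𝒟.of_prod G.1 H.1 G.2 H.2⟩

/-- The inclusion of a subgroup. -/
def Obj.incl (G : 𝒟.Obj) (K : Subgroup G) : G.sub K →* G := K.subtype

/-- The projection onto a quotient. -/
def Obj.proj (G : 𝒟.Obj) (N : Subgroup G) [N.Normal] : G →* G.quot N := QuotientGroup.mk' N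

/-- The first projection of a direct product. -/
def Obj.fst (G H : 𝒟.Obj) : G.prod H →* G := MonoidHom.fst G H

/-- The second projection of a direct product. -/
def Obj.snd (G H : 𝒟.Obj) : G.prod H →* H := MonoidHom.snd G H

end

end GroupClass

/-! ### Green biset functors -/

/-- A Green biset functor over `R`, defined on the class `𝒟`: an `R`-linear functor from the biset
category on `𝒟` to `R`-modules (`obj`, `map`, `map_id`, `map_comp`), each of whose values is a
unital `R`-algebra, such that for each group homomorphism `f : K → G` the `(K, G)`-biset `G` acts
by a ring homomorphism (`res_one`, `res_mul`), and the `(G, K)`-biset `G` satisfies the two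
Frobenius identities. -/
structure GreenBisetFunctor (R : Type w) [CommRing R] (𝒟 : GroupClass.{u}) where
  obj : 𝒟.Obj → Type v
  [ring : ∀ G, Ring (obj G)]
  [algebra : ∀ G, Algebra R (obj G)]
  map : ∀ {H G : 𝒟.Obj}, RB R H G →ₗ[R] obj G →ₗ[R] obj H
  map_id : ∀ G : 𝒟.Obj, map (RB.id R G) = LinearMap.id
  map_comp : ∀ {K H G : 𝒟.Obj} (β : RB R K H) (α : RB R H G),
    map (RB.comp R β α) = map β ∘ₗ map α
  res_one : ∀ {K G : 𝒟.Obj} (f : K →* G), map (RB.of R (FinBiset.ofHom f)) 1 = 1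
  res_mul : ∀ {K G : 𝒟.Obj} (f : K →* G) (a b : obj G),
    map (RB.of R (FinBiset.ofHom f)) (a * b) =
      map (RB.of R (FinBiset.ofHom f)) a * map (RB.of R (FinBiset.ofHom f)) b
  frobenius_left : ∀ {K G : 𝒟.Obj} (f : K →* G) (a : obj K) (b : obj G),
    map (RB.of R (FinBiset.ofHomOp f)) a * b =
      map (RB.of R (FinBiset.ofHomOp f)) (a * map (RB.of R (FinBiset.ofHom f)) b)
  frobenius_right : ∀ {K G : 𝒟.Obj} (f : K →* G) (a : obj K) (b : obj G),
    b * map (RB.of R (FinBiset.ofHomOp f)) a =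
      map (RB.of R (FinBiset.ofHomOp f)) (map (RB.of R (FinBiset.ofHom f)) b * a)

attribute [instance] GreenBisetFunctor.ring GreenBisetFunctor.algebra

/-- A finite dimensional split semisimple commutative algebra over a field: an algebra isomorphic
to a finite power `k × ⋯ × k` of the base field. -/
def IsSplitSemisimpleComm (k : Type w) [Field k] (S : Type v) [Ring S] [Algebra k S] : Prop :=
  ∃ n : ℕ, Nonempty (S ≃ₐ[k] (Fin n → k))

/-- A primitive idempotent: a non-zero idempotent that is not the sum of two non-zero orthogonal
idempotents. -/
def IsPrimitiveIdempotent {S : Type v} [Ring S] (e : S) : Prop :=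
  IsIdempotentElem e ∧ e ≠ 0 ∧
    ∀ a b : S, IsIdempotentElem a → IsIdempotentElem b → a * b = 0 → b * a = 0 →
      e = a + b → a = 0 ∨ b = 0

namespace GreenBisetFunctor

section

variable {R : Type w} [CommRing R] {𝒟 : GroupClass.{u}} (A : GreenBisetFunctor.{u, v, w} R 𝒟)

/-- Restriction to a subgroup. -/
noncomputable def Res (G : 𝒟.Obj) (K : Subgroup G) : A.obj G →ₗ[R] A.obj (G.sub K) :=
  A.map (RB.of R (FinBiset.ofHom (G.incl K)))

/-- Deflation to a quotient: the action of the `(G ⧸ N, G)`-biset `G ⧸ N`. -/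
noncomputable def Def (G : 𝒟.Obj) (N : Subgroup G) [N.Normal] :
    A.obj G →ₗ[R] A.obj (G.quot N) :=
  A.map (RB.of R (FinBiset.ofHomOp (G.proj N)))

/-- The product `A(G) × A(H) → A(G × H)`, `a × b = Inf(a) · Inf(b)`, where the inflations are taken
along the two projections of `G × H`. -/
noncomputable def cross {G H : 𝒟.Obj} (a : A.obj G) (b : A.obj H) : A.obj (G.prod H) :=
  A.map (RB.of R (FinBiset.ofHom (G.fst H))) a * A.map (RB.of R (FinBiset.ofHom (G.snd H))) b

/-- `E_G`: the set of primitive idempotents of `A(G)`. -/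
def E (G : 𝒟.Obj) : Set (A.obj G) := {e | IsPrimitiveIdempotent e}

/-- The primitive idempotents of `A(H)` whose restriction to each proper subgroup vanishes. -/
def ERes (H : 𝒟.Obj) : Set (A.obj H) :=
  {e | e ∈ A.E H ∧ ∀ K : Subgroup H, K < ⊤ → A.Res H K e = 0}

/-- The primitive idempotents of `A(H)` whose deflation to each quotient by a non-trivial normal
subgroup vanishes. -/
def EDef (H : 𝒟.Obj) : Set (A.obj H) :=
  {e | e ∈ A.E H ∧ ∀ (N : Subgroup H) [N.Normal], N ≠ ⊥ → A.Def H N e = 0}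

/-- `H` is an `MC`-group of `A`. -/
def IsMCGroup (H : 𝒟.Obj) : Prop := (A.ERes H ∩ A.EDef H).Nonempty

/-- A two-sided ideal of `A`: a biset subfunctor stable under products with elements of `A` on
both sides. -/
@[ext]
structure TwoSidedIdeal where
  carrier : ∀ G : 𝒟.Obj, Submodule R (A.obj G)
  map_mem : ∀ {H G : 𝒟.Obj} (α : RB R H G) {x : A.obj G}, x ∈ carrier G → A.map α x ∈ carrier H
  cross_mem_left : ∀ {G H : 𝒟.Obj} (a : A.obj G) {x : A.obj H}, x ∈ carrier H →
    A.cross a x ∈ carrier (G.prod H)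
  cross_mem_right : ∀ {G H : 𝒟.Obj} {x : A.obj G} (a : A.obj H), x ∈ carrier G →
    A.cross x a ∈ carrier (G.prod H)

/-- The ideal generated by `x ∈ A(G)`: the intersection of all ideals `I` with `x ∈ I(G)`. -/
def ideal {G : 𝒟.Obj} (x : A.obj G) : A.TwoSidedIdeal where
  carrier H := ⨅ I : {I : A.TwoSidedIdeal // x ∈ I.carrier G}, I.1.carrier H
  map_mem α y hy := by
    rw [Submodule.mem_iInf] at hy ⊢
    exact fun I => I.1.map_mem α (hy I)
  cross_mem_left a y hy := by
    rw [Submodule.mem_iInf] at hy ⊢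
    exact fun I => I.1.cross_mem_left a (hy I)
  cross_mem_right a hy := by
    rw [Submodule.mem_iInf] at hy ⊢
    exact fun I => I.1.cross_mem_right a (hy I)

/-- The sum of a family of ideals: `(∑ Iᵢ)(G) = ∑ Iᵢ(G)` for all `G`. -/
def idealSum {ι : Type*} (I : ι → A.TwoSidedIdeal) : A.TwoSidedIdeal where
  carrier G := ⨆ i, (I i).carrier G
  map_mem {H G} α x hx := by
    have key : (⨆ i, (I i).carrier G) ≤ (⨆ i, (I i).carrier H).comap (A.map α) :=
      iSup_le fun i x hx => Submodule.mem_iSup_of_mem i ((I i).map_mem α hx)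
    exact key hx
  cross_mem_left {G H} a x hx := by
    have key : (⨆ i, (I i).carrier H) ≤ (⨆ i, (I i).carrier (G.prod H)).comap
        (LinearMap.mulLeft R (A.map (RB.of R (FinBiset.ofHom (G.fst H))) a) ∘ₗ
          A.map (RB.of R (FinBiset.ofHom (G.snd H)))) :=
      iSup_le fun i x hx => Submodule.mem_iSup_of_mem i ((I i).cross_mem_left a hx)
    exact key hx
  cross_mem_right {G H x} a hx := by
    have key : (⨆ i, (I i).carrier G) ≤ (⨆ i, (I i).carrier (G.prod H)).comap
        (LinearMap.mulRight R (A.map (RB.of R (FinBiset.ofHom (G.snd H))) a) ∘ₗ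
          A.map (RB.of R (FinBiset.ofHom (G.fst H)))) :=
      iSup_le fun i x hx => Submodule.mem_iSup_of_mem i ((I i).cross_mem_right a hx)
    exact key hx

/-- `𝒜_I`: the class of pairs `(H, e_H)`, where `H` is an `MC`-group of `A`, the primitive
idempotent `e_H` is annihilated by all proper restrictions and all proper deflations, and
`e_H ∈ I(H)`. -/
def MCPairs (I : A.TwoSidedIdeal) : Set (Σ H : 𝒟.Obj, A.obj H) :=
  {p | A.IsMCGroup p.1 ∧ p.2 ∈ A.ERes p.1 ∩ A.EDef p.1 ∧ p.2 ∈ I.carrier p.1}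

end

end GreenBisetFunctor

end GreenBiset

/-! The first claim is a descent on the order of `G`. In a split semisimple commutative algebra,
multiplying a primitive idempotent by anything gives a scalar multiple of it
(`IsSplitSemisimpleComm.exists_smul`), so any non-zero multiple recovers it.

If `e` has a non-zero proper restriction, take `K` of least order with `Res e ≠ 0` and a primitive
`f` with `Res e * f ≠ 0`. Then `f` lies in the ideal of `e`, and by minimality its own proper
restrictions vanish. By Frobenius, `Ind f` is a multiple of `e`, so the two ideals agree as soon as
`Ind f ≠ 0`. This is `push_ne_zero`, where the Mackey formula is used: `f * Res (Ind f)` is a sum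
over double cosets `KxK`. Those whose intersection `K ∩ xKx⁻¹` is proper contribute zero, the others
contribute 0 or `f`, and the trivial one contributes `f`. The sum is a positive integer multiple of
`f`, non-zero in characteristic 0.

If `e` has a non-zero proper deflation, Frobenius alone gives a primitive `f` over the quotient with
the same ideal.

For the second claim, each `I(G)` is an ideal of `A(G)`, hence spanned by the primitive idempotents
it contains, and the first claim applies to each of them. -/

namespace GreenBiset

/-! ### Isomorphisms of bisets -/

namespace FinBiset

section

variable {K H G L : Type u} [Group K] [Group H] [Group G] [Group L]

/-- Composition of restrictions: `H ×_H G ≅ G` as `(K, G)`-bisets. -/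
theorem tensor_ofHom_ofHom [Finite H] [Finite G] (f : K →* H) (g : H →* G) :
    Iso (tensor (ofHom f) (ofHom g)) (ofHom (g.comp f)) := by
  let F : (tensor (ofHom f) (ofHom g)).carrier → G :=
    Quotient.lift (fun p : H × G => g p.1 * p.2) (by
      rintro ⟨(v : H), (x : G)⟩ _ ⟨h, rfl⟩
      change g v * x = g (v * h) * (g h⁻¹ * x)
      simp [mul_assoc])
  have hF : Function.Bijective F := by
    constructor
    · rintro ⟨(v : H), (x : G)⟩ ⟨(v' : H), (x' : G)⟩ h
      change g v * x = g v' * x' at h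
      -- The first coordinate forces this element of `H`; the second coordinate then agrees by `h`.
      refine Quotient.sound ⟨v⁻¹ * v', Prod.ext ?_ ?_⟩
      · change v' = v * (v⁻¹ * v')
        simp
      · change x' = g (v⁻¹ * v')⁻¹ * x
        simp [mul_assoc, h]
    · intro y
      exact ⟨Quotient.mk _ ((1 : H), y), by change g 1 * y = y; simp⟩
  refine ⟨Equiv.ofBijective F hF, ?_, ?_⟩
  · rintro k ⟨(v : H), (x : G)⟩
    change g (f k * v) * x = g (f k) * (g v * x)
    simp [mul_assoc]
  · rintro k ⟨(v : H), (x : G)⟩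
    change g v * (x * k.unop) = g v * x * k.unop
    simp [mul_assoc]

/-- Induction along an isomorphism is restriction along its inverse. -/
theorem ofHomOp_equiv [Finite L] [Finite H] (f : L ≃* H) :
    Iso (ofHomOp f.toMonoidHom) (ofHom f.symm.toMonoidHom) := by
  refine ⟨f.symm.toEquiv, ?_, ?_⟩
  · intro h x
    exact map_mul f.symm h x
  · intro l (x : H)
    change f.symm (x * f l.unop) = f.symm x * l.unop
    simp

/-- A subset of `G` stable under left and right multiplication by the image of `φ : K → G`,
viewed as a `(K, K)`-biset. -/
def ofStable [Finite G] (φ : K →* G) (S : Set G)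
    (hl : ∀ k, ∀ x ∈ S, φ k * x ∈ S) (hr : ∀ k, ∀ x ∈ S, x * φ k ∈ S) : FinBiset K K where
  carrier := S
  left :=
    { toSMul := ⟨fun k x => ⟨φ k * x, hl k x x.2⟩⟩
      one_smul := fun x => Subtype.ext (by change φ 1 * (x : G) = x; simp)
      mul_smul := fun a b x => Subtype.ext (by
        change φ (a * b) * (x : G) = φ a * (φ b * x); simp [mul_assoc]) }
  right :=
    { toSMul := ⟨fun k x => ⟨x * φ k.unop, hr k.unop x x.2⟩⟩
      one_smul := fun x => Subtype.ext (by change (x : G) * φ 1 = x; simp)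
      mul_smul := fun a b x => Subtype.ext (by
        change (x : G) * φ (a * b).unop = x * φ b.unop * φ a.unop; simp [mul_assoc]) }
  comm := fun k g x => Subtype.ext (by
    change φ k * ((x : G) * φ g.unop) = φ k * x * φ g.unop
    simp [mul_assoc])

/-- Restriction after induction along `φ : K → G` is given by `G` as a `(K, K)`-biset. -/
theorem tensor_ofHom_ofHomOp [Finite K] [Finite G] (φ : K →* G) :
    Iso (tensor (ofHom φ) (ofHomOp φ))
      (ofStable φ Set.univ (fun _ _ _ => trivial) (fun _ _ _ => trivial)) := by
  let F : (tensor (ofHom φ) (ofHomOp φ)).carrier → (Set.univ : Set G) :=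
    Quotient.lift (fun p : G × G => ⟨p.1 * p.2, trivial⟩) (by
      rintro ⟨(v : G), (x : G)⟩ _ ⟨h, rfl⟩
      refine Subtype.ext ?_
      change v * x = v * h * (h⁻¹ * x)
      simp [mul_assoc])
  have hF : Function.Bijective F := by
    constructor
    · rintro ⟨(v : G), (x : G)⟩ ⟨(v' : G), (x' : G)⟩ h
      replace h : (v : G) * x = v' * x' := congrArg Subtype.val h
      refine Quotient.sound ⟨(v : G)⁻¹ * v', Prod.ext ?_ ?_⟩
      · change v' = (v : G) * (v⁻¹ * v')
        simp
      · change x' = ((v : G)⁻¹ * v')⁻¹ * x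
        simp [mul_assoc, h]
    · rintro ⟨y, hy⟩
      exact ⟨Quotient.mk _ ((1 : G), y), Subtype.ext (one_mul y)⟩
  refine ⟨Equiv.ofBijective F hF, ?_, ?_⟩
  · rintro k ⟨(v : G), (x : G)⟩
    refine Subtype.ext ?_
    change φ k * v * x = φ k * (v * x)
    simp [mul_assoc]
  · rintro k ⟨(v : G), (x : G)⟩
    refine Subtype.ext ?_
    change (v : G) * (x * φ k.unop) = v * x * φ k.unop
    simp [mul_assoc]

/-- A stable subset is the disjoint union of a stable part and its complement. -/
theorem ofStable_sdiff [Finite G] (φ : K →* G) {S T : Set G} (hTS : T ⊆ S)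
    (hl : ∀ k, ∀ x ∈ S, φ k * x ∈ S) (hr : ∀ k, ∀ x ∈ S, x * φ k ∈ S)
    (hl' : ∀ k, ∀ x ∈ T, φ k * x ∈ T) (hr' : ∀ k, ∀ x ∈ T, x * φ k ∈ T)
    (hl'' : ∀ k, ∀ x ∈ S \ T, φ k * x ∈ S \ T) (hr'' : ∀ k, ∀ x ∈ S \ T, x * φ k ∈ S \ T) :
    Iso (sum (ofStable φ T hl' hr') (ofStable φ (S \ T) hl'' hr'')) (ofStable φ S hl hr) := by
  let F : T ⊕ (S \ T : Set G) → S :=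
    Sum.elim (fun x => ⟨x, hTS x.2⟩) (fun x => ⟨x, x.2.1⟩)
  have hF : Function.Bijective F := by
    constructor
    · rintro (⟨x, hx⟩ | ⟨x, hx⟩) (⟨y, hy⟩ | ⟨y, hy⟩) h <;>
        obtain rfl : x = y := congrArg Subtype.val h
      · rfl
      · exact absurd hx hy.2
      · exact absurd hy hx.2
      · rfl
    · rintro ⟨x, hx⟩
      by_cases h : x ∈ T
      · exact ⟨Sum.inl ⟨x, h⟩, rfl⟩
      · exact ⟨Sum.inr ⟨x, hx, h⟩, rfl⟩
  refine ⟨Equiv.ofBijective F hF, ?_, ?_⟩ <;> rintro k (x | x) <;> rfl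

/-- The double coset of `x` decomposes as restriction along `c` followed by induction along `f`,
whenever `f : L → K` and `c : L → K` describe the pairs `(h, k)` with `φ h * x = x * φ k`. -/
theorem tensor_ofHomOp_ofHom [Finite K] [Finite L] [Finite G] (φ : K →* G)
    (hφ : Function.Injective φ) (x : G) (f c : L →* K)
    (hfc : ∀ l, φ (f l) * x = x * φ (c l)) (hf : ∀ h k, φ h * x = x * φ k → h ∈ f.range)
    (S : Set G) (hS : S = {y | ∃ h k, φ h * x * φ k = y})
    (hl : ∀ k, ∀ x ∈ S, φ k * x ∈ S) (hr : ∀ k, ∀ x ∈ S, x * φ k ∈ S) :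
    Iso (tensor (ofHomOp f) (ofHom c)) (ofStable φ S hl hr) := by
  subst hS
  let F : (tensor (ofHomOp f) (ofHom c)).carrier → {y | ∃ h k, φ h * x * φ k = y} :=
    Quotient.lift (fun p : K × K => ⟨φ p.1 * x * φ p.2, _, _, rfl⟩) (by
      rintro ⟨(v : K), (y : K)⟩ _ ⟨l, rfl⟩
      refine Subtype.ext ?_
      change φ v * x * φ y = φ (v * f l) * x * φ (c l⁻¹ * y)
      have := hfc l
      simp only [map_mul, mul_assoc, map_inv]
      rw [← mul_assoc (φ (f l)), this]
      simp [mul_assoc])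
  have hF : Function.Bijective F := by
    constructor
    · rintro ⟨(v : K), (y : K)⟩ ⟨(v' : K), (y' : K)⟩ h
      replace h : φ v * x * φ y = φ v' * x * φ y' := congrArg Subtype.val h
      -- Two representations of one point of the double coset differ by a pair satisfying the
      -- relation in `hf`, hence by some `l : L`.
      have h1 : φ (v⁻¹ * v') * x = x * φ (y * y'⁻¹) := by
        simp only [map_mul, map_inv]
        rw [mul_assoc, inv_mul_eq_iff_eq_mul, ← mul_assoc, ← mul_assoc, eq_mul_inv_iff_mul_eq, h]
      obtain ⟨l, hl⟩ := hf _ _ h1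
      have h2 : c l = y * y'⁻¹ := hφ (mul_left_cancel ((hfc l).symm.trans (hl ▸ h1)))
      refine Quotient.sound ⟨l, Prod.ext ?_ ?_⟩
      · change v' = v * f l
        simp [hl]
      · change y' = c l⁻¹ * y
        simp [h2]
    · rintro ⟨_, h, k, rfl⟩
      exact ⟨Quotient.mk _ (h, k), rfl⟩
  refine ⟨Equiv.ofBijective F hF, ?_, ?_⟩
  · rintro k ⟨(v : K), (y : K)⟩
    refine Subtype.ext ?_
    change φ (k * v) * x * φ y = φ k * (φ v * x * φ y)
    simp [mul_assoc]
  · rintro k ⟨(v : K), (y : K)⟩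
    refine Subtype.ext ?_
    change φ v * x * φ (y * k.unop) = φ v * x * φ y * φ k.unop
    simp [mul_assoc]

end

end FinBiset

/-! ### Classes of bisets and their composition in the biset category -/

namespace RB

section

variable (R : Type w) [CommRing R] {K H G : Type u} [Group K] [Group H] [Group G]

variable {R} in
theorem of_congr {X Y : FinBiset H G} (h : FinBiset.Iso X Y) : of R X = of R Y :=
  congrArg (fun z => 1 ⊗ₜ[ℤ] Algebra.GrothendieckAddGroup.of z)
    (Quotient.sound (s := FinBiset.setoid H G) h)

theorem of_sum (X Y : FinBiset H G) : of R (X.sum Y) = of R X + of R Y := by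
  rw [of, of, of, ← TensorProduct.tmul_add, ← map_add]
  rfl

/-- Through this, isomorphisms of actual bisets become identities between the maps of a Green biset
functor. -/
theorem comp_of (V : FinBiset K H) (U : FinBiset H G) :
    comp R (of R V) (of R U) = of R (V.tensor U) := by
  have h (W : BisetClass K H) (f : BisetClass K H →+ BurnsideGroup H G →+ BurnsideGroup K G) :
      Algebra.GrothendieckAddGroup.lift f (Algebra.GrothendieckAddGroup.of W) = f W :=
    DFunLike.congr_fun (Algebra.GrothendieckAddGroup.lift.symm_apply_apply f) W
  have h' (W : BisetClass H G) (f : BisetClass H G →+ BurnsideGroup K G) :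
      Algebra.GrothendieckAddGroup.lift f (Algebra.GrothendieckAddGroup.of W) = f W :=
    DFunLike.congr_fun (Algebra.GrothendieckAddGroup.lift.symm_apply_apply f) W
  simp only [comp, of, LinearMap.liftBaseChange_tmul, one_smul]
  change LinearMap.baseChange R _ _ = _
  rw [LinearMap.baseChange_tmul]
  congr 1
  change BurnsideGroup.comp _ _ = _
  rw [BurnsideGroup.comp, h]
  exact h' _ _

end

end RB

/-! ### Split semisimple commutative algebras -/

section

variable {k : Type w} [Field k] {S : Type v} [Ring S] [Algebra k S]

/-- A split semisimple commutative algebra has a complete family of one-dimensional primitive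
idempotents. -/
theorem IsSplitSemisimpleComm.exists_idempotents (h : IsSplitSemisimpleComm k S) :
    ∃ (n : ℕ) (b : Fin n → S), (∀ i, IsPrimitiveIdempotent (b i)) ∧ ∑ i, b i = 1 ∧
      ∀ i a, ∃ c : k, a * b i = c • b i := by
  obtain ⟨n, ⟨ψ⟩⟩ := h
  have hb (i : Fin n) (a : S) :
      a * ψ.symm (Pi.single i 1) = (ψ a i) • ψ.symm (Pi.single i 1) := by
    refine ψ.injective ?_
    rw [map_mul, map_smul, ψ.apply_symm_apply]
    ext j
    by_cases hj : j = i
    · subst hj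
      simp
    · simp [hj]
  have hidem (i : Fin n) : IsIdempotentElem (ψ.symm (Pi.single i 1)) := by
    rw [IsIdempotentElem, hb]
    simp
  have hne (i : Fin n) : ψ.symm (Pi.single i 1) ≠ 0 := by
    simp
  refine ⟨n, fun i => ψ.symm (Pi.single i 1), fun i => ⟨hidem i, hne i, ?_⟩, ?_, fun i a => ⟨_, hb i a⟩⟩
  · intro a b ha hb' hab hba he
    change ψ.symm (Pi.single i 1) = a + b at he
    -- By orthogonality, `a` and `b` are their own products with the `i`-th idempotent, hence
    -- multiples of it; the two scalars multiply to zero.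
    have h1 : a = ψ a i • ψ.symm (Pi.single i 1) := by
      rw [← hb, he, mul_add, hab, add_zero, ha]
    have h2 : b = ψ b i • ψ.symm (Pi.single i 1) := by
      rw [← hb, he, mul_add, hba, zero_add, hb']
    have h3 : ψ a i * ψ b i = 0 := by
      rw [← Pi.mul_apply, ← map_mul, hab, map_zero, Pi.zero_apply]
    rcases mul_eq_zero.mp h3 with h3 | h3
    · left
      rw [h1, h3, zero_smul]
    · right
      rw [h2, h3, zero_smul]
  · rw [← map_sum, Finset.univ_sum_single, ← map_one ψ.symm]
    rfl

theorem IsSplitSemisimpleComm.mul_comm (h : IsSplitSemisimpleComm k S) (a b : S) :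
    a * b = b * a := by
  obtain ⟨n, ⟨ψ⟩⟩ := h
  exact ψ.injective (by rw [map_mul, map_mul, _root_.mul_comm])

/-- A non-zero element has a non-zero product with some primitive idempotent. -/
theorem IsSplitSemisimpleComm.exists_mul_ne_zero (h : IsSplitSemisimpleComm k S) {x : S}
    (hx : x ≠ 0) : ∃ b, IsPrimitiveIdempotent b ∧ x * b ≠ 0 := by
  obtain ⟨n, b, hb, hsum, -⟩ := h.exists_idempotents
  by_contra! hc
  refine hx ?_
  rw [← mul_one x, ← hsum, Finset.mul_sum]
  exact Finset.sum_eq_zero fun i _ => hc _ (hb i)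

/-- A primitive idempotent spans the ideal it generates. -/
theorem IsSplitSemisimpleComm.exists_smul (h : IsSplitSemisimpleComm k S) {e : S}
    (he : IsPrimitiveIdempotent e) (a : S) : ∃ c : k, a * e = c • e := by
  obtain ⟨n, b, hb, hsum, hspan⟩ := h.exists_idempotents
  have hcomm := h.mul_comm
  obtain ⟨i, hi⟩ : ∃ i, e * b i ≠ 0 := by
    by_contra! hc
    refine he.2.1 ?_
    rw [← mul_one e, ← hsum, Finset.mul_sum]
    exact Finset.sum_eq_zero fun i _ => hc i
  have h1 : IsIdempotentElem (e * b i) := he.1.mul_of_commute (hcomm _ _) (hb i).1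
  have h3 : IsIdempotentElem (e * (1 - b i)) := he.1.mul_of_commute (hcomm _ _) (hb i).1.one_sub
  have h2 : e * b i * (e * (1 - b i)) = 0 := by
    rw [hcomm e (1 - b i), mul_assoc, ← mul_assoc (b i), (hb i).1.mul_one_sub_self, zero_mul,
      mul_zero]
  -- Primitivity applied to `e = e * b i + e * (1 - b i)` leaves only `e = e * b i`, a multiple of
  -- `b i`.
  rcases he.2.2 _ _ h1 h3 h2 (by rw [hcomm, h2]) (by rw [← mul_add]; simp) with h | h
  · exact absurd h hi
  · obtain ⟨c, hc⟩ := hspan i e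
    have h4 : e = c • b i := by
      rw [← hc]
      rwa [mul_sub, mul_one, sub_eq_zero] at h
    obtain ⟨d, hd⟩ := hspan i a
    refine ⟨d, ?_⟩
    rw [h4, mul_smul_comm, hd, smul_comm]

end

/-! ### Formal calculus of pullbacks, pushforwards and ideals -/

namespace GreenBisetFunctor

section

variable {R : Type w} [CommRing R] {𝒟 : GroupClass.{u}} (A : GreenBisetFunctor.{u, v, w} R 𝒟)

/-- The map `f^*` induced by the `(K, G)`-biset `G`. -/
noncomputable def pull {K G : 𝒟.Obj} (f : K →* G) : A.obj G →ₗ[R] A.obj K :=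
  A.map (RB.of R (FinBiset.ofHom f))

/-- The map `f_*` induced by the `(G, K)`-biset `G`. -/
noncomputable def push {K G : 𝒟.Obj} (f : K →* G) : A.obj K →ₗ[R] A.obj G :=
  A.map (RB.of R (FinBiset.ofHomOp f))

theorem map_tensor {K H G : 𝒟.Obj} (V : FinBiset K H) (U : FinBiset H G) (a : A.obj G) :
    A.map (RB.of R (V.tensor U)) a = A.map (RB.of R V) (A.map (RB.of R U) a) := by
  rw [← RB.comp_of, A.map_comp]
  rfl

theorem pull_pull {K H G : 𝒟.Obj} (f : K →* H) (g : H →* G) (a : A.obj G) :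
    A.pull f (A.pull g a) = A.pull (g.comp f) a := by
  rw [pull, pull, ← map_tensor, RB.of_congr (FinBiset.tensor_ofHom_ofHom f g)]
  rfl

theorem pull_id {G : 𝒟.Obj} (a : A.obj G) : A.pull (MonoidHom.id G) a = a :=
  LinearMap.congr_fun (A.map_id G) a

theorem push_equiv {L K : 𝒟.Obj} (f : L ≃* K) :
    A.push f.toMonoidHom = A.pull f.symm.toMonoidHom := by
  rw [push, pull, RB.of_congr (FinBiset.ofHomOp_equiv f)]

theorem isIdempotentElem_pull {K G : 𝒟.Obj} (f : K →* G) {a : A.obj G} (ha : IsIdempotentElem a) :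
    IsIdempotentElem (A.pull f a) := by
  rw [IsIdempotentElem, pull, ← A.res_mul, ha]

/-- Restriction to the image determines restriction along a homomorphism. -/
theorem pull_eq_zero_of_Res {K G : 𝒟.Obj} (f : K →* G) {a : A.obj G}
    (h : A.Res G f.range a = 0) : A.pull f a = 0 := by
  have : A.pull (K := K) (G := G.sub f.range) f.rangeRestrict (A.Res G f.range a) = A.pull f a :=
    A.pull_pull (K := K) (H := G.sub f.range) f.rangeRestrict (G.incl f.range) a
  rw [← this, h, map_zero]

variable {A}

/-- The value of an ideal is stable under multiplication. -/
theorem TwoSidedIdeal.mul_mem_left (I : A.TwoSidedIdeal) {G : 𝒟.Obj} (a : A.obj G) {x : A.obj G}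
    (hx : x ∈ I.carrier G) : a * x ∈ I.carrier G := by
  -- The diagonal composed with either projection is the identity, so pulling `a × x` back along it
  -- gives `a * x`.
  let δ : G →* G.prod G := (MonoidHom.id G).prod (MonoidHom.id G)
  have h := I.map_mem (RB.of R (FinBiset.ofHom δ)) (I.cross_mem_left a hx)
  rw [cross, A.res_mul] at h
  have h1 : A.pull δ (A.pull (G.fst G) a) = a := by
    rw [pull_pull]
    exact A.pull_id a
  have h2 : A.pull δ (A.pull (G.snd G) x) = x := by
    rw [pull_pull]
    exact A.pull_id x
  rw [pull, pull] at h1 h2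
  rwa [h1, h2] at h

variable (A)

theorem mem_ideal_self {G : 𝒟.Obj} (x : A.obj G) : x ∈ (A.ideal x).carrier G :=
  (Submodule.mem_iInf _).mpr fun I => I.2

variable {A}

theorem ideal_carrier_le {G : 𝒟.Obj} {x : A.obj G} {I : A.TwoSidedIdeal} (h : x ∈ I.carrier G)
    (H : 𝒟.Obj) : (A.ideal x).carrier H ≤ I.carrier H :=
  iInf_le (fun I : {I : A.TwoSidedIdeal // x ∈ I.carrier G} => I.1.carrier H) ⟨I, h⟩

theorem ideal_eq_ideal {G H : 𝒟.Obj} {x : A.obj G} {y : A.obj H}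
    (hx : x ∈ (A.ideal y).carrier G) (hy : y ∈ (A.ideal x).carrier H) : A.ideal x = A.ideal y :=
  TwoSidedIdeal.ext (funext fun L => le_antisymm (ideal_carrier_le hx L) (ideal_carrier_le hy L))

end

/-! ### Mackey decomposition and non-vanishing of induction -/

section

variable {k : Type w} [Field k] {𝒟 : GroupClass.{u}} {A : GreenBisetFunctor.{u, v, w} k 𝒟}
  (hA : ∀ G : 𝒟.Obj, IsSplitSemisimpleComm k (A.obj G))

include hA

/-- Multiplying the action of a double coset on a primitive idempotent with vanishing proper
restrictions by that idempotent gives a natural multiple. -/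
theorem exists_nsmul_of_doubleCoset {K G : 𝒟.Obj} (φ : K →* G) (hφ : Function.Injective φ)
    {e : A.obj K} (he : e ∈ A.ERes K) (x : G) (S : Set G)
    (hS : S = {y | ∃ h k, φ h * x * φ k = y})
    (hl : ∀ k, ∀ x ∈ S, φ k * x ∈ S) (hr : ∀ k, ∀ x ∈ S, x * φ k ∈ S) :
    ∃ n : ℕ, A.map (RB.of k (FinBiset.ofStable φ S hl hr)) e * e = n • e := by
  -- `L` is `K ∩ xKx⁻¹` seen inside `K`, and `c` below is conjugation by `x⁻¹` from `L` to `K`.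
  let L : Subgroup K := (φ.range.map (MulAut.conj x).toMonoidHom).comap φ
  have hL : ∀ l : K, l ∈ L ↔ ∃ h, φ l * x = x * φ h := by
    intro l
    simp only [L, Subgroup.mem_comap, Subgroup.mem_map, MonoidHom.mem_range, exists_exists_eq_and]
    refine exists_congr fun h => ?_
    change x * φ h * x⁻¹ = φ l ↔ _
    rw [mul_inv_eq_iff_eq_mul, eq_comm]
  choose c₀ hc₀ using fun l : L => (hL l).mp l.2
  let c₁ : L →* K :=
    { toFun := c₀
      map_one' := hφ (mul_left_cancel (a := x) (by rw [← hc₀]; simp))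
      map_mul' := fun a b => hφ (mul_left_cancel (a := x) (by
        rw [← hc₀, map_mul, ← mul_assoc, ← hc₀, mul_assoc, ← hc₀, Subgroup.coe_mul, map_mul,
          mul_assoc])) }
  let c : K.sub L →* K := c₁
  have hiso := FinBiset.tensor_ofHomOp_ofHom φ hφ x (K.incl L) c hc₀
    (fun h k hk => ⟨⟨h, (hL h).mpr ⟨k, hk⟩⟩, rfl⟩) S hS hl hr
  rw [← RB.of_congr hiso, map_tensor]
  -- If `c` is onto, counting forces `L = K`; otherwise `e` already dies on the proper subgroup
  -- `c.range`.
  by_cases hc : c.range = ⊤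
  · have hLtop : L = ⊤ := by
      refine Subgroup.eq_top_of_le_card _ ?_
      exact Nat.card_le_card_of_surjective c (MonoidHom.range_eq_top.mp hc)
    have hbij : Function.Bijective (K.incl L) :=
      ⟨Subtype.val_injective, fun y => ⟨⟨y, hLtop ▸ trivial⟩, rfl⟩⟩
    let E : K.sub L ≃* K := MulEquiv.ofBijective (K.incl L) hbij
    -- Induction along an isomorphism is pullback along its inverse, so it preserves idempotents.
    have hq : IsIdempotentElem (A.push (K.incl L) (A.pull c e)) := by
      have h := A.push_equiv E
      change A.push (K.incl L) = _ at h
      rw [h]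
      exact A.isIdempotentElem_pull _ (A.isIdempotentElem_pull _ he.1.1)
    change ∃ n : ℕ, A.push (K.incl L) (A.pull c e) * e = n • e
    set q := A.push (K.incl L) (A.pull c e)
    obtain ⟨r, hr⟩ := (hA K).exists_smul he.1 q
    -- Since `q` is idempotent, its scalar on `e` is 0 or 1; this is why the multiple is a natural
    -- number.
    have h2 : (r * r) • e = r • e := by
      rw [mul_smul, ← hr, ← mul_smul_comm, ← hr, ← mul_assoc, hq]
    have h3 : r * r = r := smul_left_injective k he.1.2.1 h2
    rcases IsIdempotentElem.iff_eq_zero_or_one.mp h3 with h | h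
    · exact ⟨0, by rw [hr, h]; simp⟩
    · exact ⟨1, by rw [hr, h]; simp⟩
  · refine ⟨0, ?_⟩
    have h0 : A.pull c e = 0 :=
      A.pull_eq_zero_of_Res c (he.2 c.range (lt_top_iff_ne_top.mpr hc))
    rw [pull] at h0
    rw [h0, map_zero, zero_mul, zero_smul]

/-- A stable set is a disjoint union of double cosets, removed one at a time by induction on
cardinality. Naturality of the multiple rules out later cancellation. -/
theorem exists_nsmul_of_stable {K G : 𝒟.Obj} (φ : K →* G) (hφ : Function.Injective φ)
    {e : A.obj K} (he : e ∈ A.ERes K) (S : Set G)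
    (hl : ∀ k, ∀ x ∈ S, φ k * x ∈ S) (hr : ∀ k, ∀ x ∈ S, x * φ k ∈ S) :
    ∃ n : ℕ, A.map (RB.of k (FinBiset.ofStable φ S hl hr)) e * e = n • e := by
  induction hn : S.ncard using Nat.strong_induction_on generalizing S with
  | _ n ih =>
    rcases S.eq_empty_or_nonempty with rfl | ⟨x, hx⟩
    · refine ⟨0, ?_⟩
      have h0 : RB.of k (FinBiset.ofStable φ ∅ hl hr) = 0 := by
        have : FinBiset.Iso (FinBiset.ofStable φ ∅ hl hr) (FinBiset.empty K K) :=
          ⟨Equiv.equivPEmpty (∅ : Set G), fun _ x => x.2.elim, fun _ x => x.2.elim⟩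
        rw [RB.of_congr this]
        exact (congrArg (fun z => 1 ⊗ₜ[ℤ] z) (map_zero _)).trans (TensorProduct.tmul_zero _ _)
      rw [h0]
      simp
    · set D : Set G := {y | ∃ h k, φ h * x * φ k = y} with hD
      have hDS : D ⊆ S := by
        rintro _ ⟨h, l, rfl⟩
        exact hr _ _ (hl _ _ hx)
      have hl' : ∀ k, ∀ x ∈ D, φ k * x ∈ D := by
        rintro a _ ⟨h, l, rfl⟩
        exact ⟨a * h, l, by simp [mul_assoc]⟩
      have hr' : ∀ k, ∀ x ∈ D, x * φ k ∈ D := by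
        rintro a _ ⟨h, l, rfl⟩
        exact ⟨h, l * a, by simp [mul_assoc]⟩
      have hl'' : ∀ k, ∀ x ∈ S \ D, φ k * x ∈ S \ D := fun a y hy =>
        ⟨hl _ _ hy.1, fun h => hy.2 (by simpa using hl' a⁻¹ _ h)⟩
      have hr'' : ∀ k, ∀ x ∈ S \ D, x * φ k ∈ S \ D := fun a y hy =>
        ⟨hr _ _ hy.1, fun h => hy.2 (by simpa using hr' a⁻¹ _ h)⟩
      have hlt : (S \ D).ncard < n := by
        rw [← hn]
        exact Set.ncard_lt_ncard ⟨Set.sdiff_subset, fun h => (h hx).2 ⟨1, 1, by simp⟩⟩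
      obtain ⟨a, ha⟩ := exists_nsmul_of_doubleCoset hA φ hφ he x D hD hl' hr'
      obtain ⟨b, hb⟩ := ih _ hlt (S \ D) hl'' hr'' rfl
      refine ⟨a + b, ?_⟩
      rw [← RB.of_congr (FinBiset.ofStable_sdiff φ hDS hl hr hl' hr' hl'' hr''), RB.of_sum,
        map_add, LinearMap.add_apply, add_mul, ha, hb, add_smul]

/-- Induction along an injective homomorphism does not kill a primitive idempotent whose proper
restrictions vanish. -/
theorem push_ne_zero [CharZero k] {K G : 𝒟.Obj} (φ : K →* G) (hφ : Function.Injective φ)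
    {e : A.obj K} (he : e ∈ A.ERes K) : A.push φ e ≠ 0 := by
  intro h0
  have hT : FinBiset.Iso (FinBiset.ofHom (MonoidHom.id K)) (FinBiset.ofStable φ (φ.range : Set G)
      (fun k x hx => mul_mem ⟨k, rfl⟩ hx) (fun k x hx => mul_mem hx ⟨k, rfl⟩)) := by
    refine ⟨(MonoidHom.ofInjective hφ).toEquiv, ?_, ?_⟩
    · intro h x
      exact Subtype.ext (map_mul φ h x)
    · intro h (x : K)
      exact Subtype.ext (map_mul φ x h.unop)
  have hl'' : ∀ k, ∀ x ∈ Set.univ \ (φ.range : Set G), φ k * x ∈ Set.univ \ (φ.range : Set G) :=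
    fun a y hy => ⟨trivial, fun h => hy.2 (by
      simpa using mul_mem (⟨a⁻¹, rfl⟩ : φ a⁻¹ ∈ φ.range) h)⟩
  have hr'' : ∀ k, ∀ x ∈ Set.univ \ (φ.range : Set G), x * φ k ∈ Set.univ \ (φ.range : Set G) :=
    fun a y hy => ⟨trivial, fun h => hy.2 (by
      simpa [mul_assoc] using mul_mem h (⟨a⁻¹, rfl⟩ : φ a⁻¹ ∈ φ.range))⟩
  -- The trivial double coset `φ.range` is kept apart: it acts as the identity and turns the
  -- coefficient `n` into `n + 1`, which cannot vanish.
  obtain ⟨n, hn⟩ := exists_nsmul_of_stable hA φ hφ he _ hl'' hr''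
  have hU := FinBiset.ofStable_sdiff φ (Set.subset_univ (φ.range : Set G))
    (fun _ _ _ => trivial) (fun _ _ _ => trivial) (fun k x hx => mul_mem ⟨k, rfl⟩ hx)
    (fun k x hx => mul_mem hx ⟨k, rfl⟩) hl'' hr''
  have h1 : A.pull φ (A.push φ e) * e = (n + 1) • e := by
    rw [pull, push, ← map_tensor, RB.of_congr (FinBiset.tensor_ofHom_ofHomOp φ),
      ← RB.of_congr hU, RB.of_sum, ← RB.of_congr hT, map_add, LinearMap.add_apply, add_mul, hn, add_smul, one_smul, add_comm]
    congr 1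
    exact (congrArg (· * e) (A.pull_id e)).trans he.1.1
  rw [h0, map_zero, zero_mul, ← Nat.cast_smul_eq_nsmul k] at h1
  rcases smul_eq_zero.mp h1.symm with h | h
  · exact Nat.cast_ne_zero.mpr n.succ_ne_zero h
  · exact he.1.2.1 h

/-! ### Descent to smaller groups and the two claims -/

/-- A primitive idempotent with a non-zero proper restriction generates the same ideal as a
primitive idempotent of a smaller group. -/
theorem exists_ideal_eq_of_Res_ne_zero [CharZero k] {G : 𝒟.Obj} {e : A.obj G} (he : e ∈ A.E G)
    (h : ∃ K : Subgroup G, K < ⊤ ∧ A.Res G K e ≠ 0) :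
    ∃ (H : 𝒟.Obj) (f : A.obj H), f ∈ A.E H ∧ Nat.card H < Nat.card G ∧
      A.ideal e = A.ideal f := by
  classical
  obtain ⟨K₀, hK₀, hne₀⟩ := h
  -- The minimum runs over all subgroups; comparison with `K₀` shows that the minimiser is proper.
  have hex : ∃ n, ∃ K : Subgroup G, A.Res G K e ≠ 0 ∧ Nat.card K = n := ⟨_, K₀, hne₀, rfl⟩
  obtain ⟨K, hne, hcard⟩ := Nat.find_spec hex
  have hmin : ∀ K' : Subgroup G, Nat.card K' < Nat.card K → A.Res G K' e = 0 := fun K' hK' => by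
    by_contra hc
    exact Nat.find_min hex (hcard ▸ hK') ⟨K', hc, rfl⟩
  have hlt : Nat.card K < Nat.card G := by
    refine lt_of_le_of_lt (hcard ▸ Nat.find_min' hex ⟨K₀, hne₀, rfl⟩) ?_
    refine lt_of_le_of_ne (Subgroup.card_le_card_group K₀) fun h => hK₀.ne ?_
    exact Subgroup.eq_top_of_card_eq K₀ h
  let φ : G.sub K →* G := G.incl K
  obtain ⟨f, hf, hfne⟩ := (hA (G.sub K)).exists_mul_ne_zero hne
  obtain ⟨r, hr⟩ := (hA (G.sub K)).exists_smul hf (A.pull φ e)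
  have hr0 : r ≠ 0 := by
    rintro rfl
    exact hfne (hr.trans (zero_smul _ _))
  have hfe : f = r⁻¹ • (A.pull φ e * f) := by
    rw [hr, smul_smul, inv_mul_cancel₀ hr0, one_smul]
  have hfRes : f ∈ A.ERes (G.sub K) := by
    refine ⟨hf, fun K' hK' => ?_⟩
    -- The composite inclusion has image in `G` of order less than that of `K`, so minimality
    -- applies to that image.
    have h0 : A.pull ((G.sub K).incl K') (A.pull φ e) = 0 := by
      rw [pull_pull]
      refine A.pull_eq_zero_of_Res _ (hmin _ ?_)
      refine lt_of_le_of_lt (Nat.card_le_card_of_surjective _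
        (MonoidHom.rangeRestrict_surjective _)) ?_
      refine lt_of_le_of_ne (Subgroup.card_le_card_group K') fun h => hK'.ne ?_
      exact Subgroup.eq_top_of_card_eq K' h
    change A.pull ((G.sub K).incl K') f = 0
    have h1 : A.pull ((G.sub K).incl K') (A.pull φ e * f) = 0 := by
      have := A.res_mul ((G.sub K).incl K') (A.pull φ e) f
      change A.pull _ _ = A.pull _ _ * A.pull _ _ at this
      rw [this, h0, zero_mul]
    rw [hfe, map_smul, h1, smul_zero]
  refine ⟨G.sub K, f, hf, hlt, ideal_eq_ideal ?_ ?_⟩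
  · have hp := push_ne_zero hA φ Subtype.val_injective hfRes
    have h1 : A.push φ (A.pull φ e * f) = e * A.push φ f := (A.frobenius_right φ f e).symm
    obtain ⟨s, hs⟩ := (hA G).exists_smul he (A.push φ f)
    -- Frobenius makes `Ind f` a multiple of `e`; as it is non-zero, the scalar can be inverted to
    -- put `e` in the ideal of `f`.
    have h2 : A.push φ f = (r⁻¹ * s) • e := by
      conv_lhs => rw [hfe]
      rw [map_smul, h1, (hA G).mul_comm, hs, smul_smul]
    have h3 : r⁻¹ * s ≠ 0 := fun h => hp (by rw [h2, h, zero_smul])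
    have h4 : e = (r⁻¹ * s)⁻¹ • A.push φ f := by
      rw [h2, smul_smul, inv_mul_cancel₀ h3, one_smul]
    rw [h4]
    exact Submodule.smul_mem _ _ ((A.ideal f).map_mem _ (A.mem_ideal_self f))
  · rw [hfe, (hA (G.sub K)).mul_comm]
    exact Submodule.smul_mem _ _ ((A.ideal e).mul_mem_left _
      ((A.ideal e).map_mem _ (A.mem_ideal_self e)))

/-- A primitive idempotent with a non-zero proper deflation generates the same ideal as a
primitive idempotent of a smaller group. -/
theorem exists_ideal_eq_of_Def_ne_zero {G : 𝒟.Obj} {e : A.obj G} (he : e ∈ A.E G)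
    (N : Subgroup G) [N.Normal] (hN : N ≠ ⊥) (h : A.Def G N e ≠ 0) :
    ∃ (H : 𝒟.Obj) (f : A.obj H), f ∈ A.E H ∧ Nat.card H < Nat.card G ∧
      A.ideal e = A.ideal f := by
  let π : G →* G.quot N := G.proj N
  obtain ⟨f, hf, hfne⟩ := (hA (G.quot N)).exists_mul_ne_zero h
  change A.push π e * f ≠ 0 at hfne
  obtain ⟨r, hr⟩ := (hA (G.quot N)).exists_smul hf (A.push π e)
  have hr0 : r ≠ 0 := by
    rintro rfl
    exact hfne (hr.trans (zero_smul _ _))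
  have hfe : f = r⁻¹ • (A.push π e * f) := by
    rw [hr, smul_smul, inv_mul_cancel₀ hr0, one_smul]
  -- The left side is non-zero, so `e * Inf f` is a non-zero multiple of `e`, which puts `e` in the
  -- ideal of `f`.
  have hfrob : A.push π e * f = A.push π (e * A.pull π f) := A.frobenius_left π e f
  obtain ⟨s, hs⟩ := (hA G).exists_smul he (A.pull π f)
  have hs0 : s ≠ 0 := by
    rintro rfl
    refine hfne ?_
    rw [hfrob, (hA G).mul_comm, hs, zero_smul, map_zero]
  have hef : e = s⁻¹ • (A.pull π f * e) := by
    rw [hs, smul_smul, inv_mul_cancel₀ hs0, one_smul]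
  refine ⟨G.quot N, f, hf, ?_, ideal_eq_ideal ?_ ?_⟩
  · change Nat.card (G ⧸ N) < Nat.card G
    rw [Subgroup.card_eq_card_quotient_mul_card_subgroup N]
    exact lt_mul_of_one_lt_right Nat.card_pos ((Subgroup.one_lt_card_iff_ne_bot N).mpr hN)
  · rw [hef, (hA G).mul_comm]
    exact Submodule.smul_mem _ _ ((A.ideal f).mul_mem_left _
      ((A.ideal f).map_mem _ (A.mem_ideal_self f)))
  · rw [hfe, (hA (G.quot N)).mul_comm]
    exact Submodule.smul_mem _ _ ((A.ideal e).mul_mem_left _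
      ((A.ideal e).map_mem _ (A.mem_ideal_self e)))

/-- Every primitive idempotent generates the same ideal as one whose proper restrictions and
proper deflations all vanish. -/
theorem exists_MCGroup_ideal_eq [CharZero k] (G : 𝒟.Obj) (e : A.obj G) (he : e ∈ A.E G) :
    ∃ H : 𝒟.Obj, A.IsMCGroup H ∧ ∃ f ∈ A.ERes H ∩ A.EDef H, A.ideal e = A.ideal f := by
  induction hn : Nat.card G using Nat.strong_induction_on generalizing G with
  | _ n ih =>
    subst hn
    have step : (∃ (H : 𝒟.Obj) (f : A.obj H), f ∈ A.E H ∧ Nat.card H < Nat.card G ∧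
        A.ideal e = A.ideal f) →
        ∃ H : 𝒟.Obj, A.IsMCGroup H ∧ ∃ f ∈ A.ERes H ∩ A.EDef H, A.ideal e = A.ideal f := by
      rintro ⟨H, f, hf, hlt, heq⟩
      rw [heq]
      exact ih _ hlt H f hf rfl
    by_cases h1 : ∃ K : Subgroup G, K < ⊤ ∧ A.Res G K e ≠ 0
    · exact step (exists_ideal_eq_of_Res_ne_zero hA he h1)
    by_cases h2 : ∃ (N : Subgroup G) (_ : N.Normal), N ≠ ⊥ ∧ A.Def G N e ≠ 0
    · obtain ⟨N, _, hN, hne⟩ := h2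
      exact step (exists_ideal_eq_of_Def_ne_zero hA he N hN hne)
    push Not at h1 h2
    have hmem : e ∈ A.ERes G ∩ A.EDef G := ⟨⟨he, h1⟩, ⟨he, fun N hN => h2 N hN⟩⟩
    exact ⟨G, ⟨e, hmem⟩, e, hmem, rfl⟩

/-- An element of `I(G)` is the sum of its components `x * b i = c • b i`. Whenever `c ≠ 0`, the
idempotent `b i` itself lies in `I(G)` and can be traded for one over an MC-group. -/
theorem eq_idealSum_MCPairs [CharZero k] (I : A.TwoSidedIdeal) :
    I = A.idealSum fun p : A.MCPairs I => A.ideal p.1.2 := by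
  refine TwoSidedIdeal.ext (funext fun G => le_antisymm (fun x hx => ?_) ?_)
  · obtain ⟨n, b, hb, hsum, hspan⟩ := (hA G).exists_idempotents
    rw [← mul_one x, ← hsum, Finset.mul_sum]
    refine Submodule.sum_mem _ fun i _ => ?_
    obtain ⟨c, hc⟩ := hspan i x
    rw [hc]
    by_cases hc0 : c = 0
    · rw [hc0, zero_smul]
      exact Submodule.zero_mem _
    refine Submodule.smul_mem _ _ ?_
    have hbI : b i ∈ I.carrier G := by
      have h : b i = c⁻¹ • (b i * x) := by
        rw [(hA G).mul_comm, hc, smul_smul, inv_mul_cancel₀ hc0, one_smul]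
      rw [h]
      exact Submodule.smul_mem _ _ (I.mul_mem_left _ hx)
    obtain ⟨H, hH, f, hf, heq⟩ := exists_MCGroup_ideal_eq hA G (b i) (hb i)
    -- Equality of ideals carries membership in `I` from `b i` to `f`, so the pair `(H, f)` indexes
    -- a summand.
    have hfI : f ∈ I.carrier H :=
      ideal_carrier_le hbI H (heq ▸ A.mem_ideal_self f)
    refine Submodule.mem_iSup_of_mem (⟨⟨H, f⟩, hH, hf, hfI⟩ : A.MCPairs I) ?_
    change b i ∈ (A.ideal f).carrier G
    rw [← heq]
    exact A.mem_ideal_self _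
  · exact iSup_le fun p => ideal_carrier_le p.2.2.2 G

end

end GreenBisetFunctor

end GreenBiset

theorem mainTheorem3 {k : Type w} [Field k] [CharZero k] {𝒟 : GreenBiset.GroupClass.{u}}
    (A : GreenBiset.GreenBisetFunctor.{u, v, w} k 𝒟)
    (hA : ∀ G : 𝒟.Obj, GreenBiset.IsSplitSemisimpleComm k (A.obj G)) :
    (∀ (G : 𝒟.Obj) (e_G : A.obj G), e_G ∈ A.E G →
      ∃ H : 𝒟.Obj, A.IsMCGroup H ∧ ∃ e_H ∈ A.ERes H ∩ A.EDef H, A.ideal e_G = A.ideal e_H) ∧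
    (∀ I : A.TwoSidedIdeal,
      I = A.idealSum fun p : A.MCPairs I => A.ideal p.1.2) :=
  ⟨GreenBiset.GreenBisetFunctor.exists_MCGroup_ideal_eq hA,
    GreenBiset.GreenBisetFunctor.eq_idealSum_MCPairs hA⟩
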